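/- Algebras are complex associative algebras, and a norm on an algebra means a submultiplicative, not necessarily complete, norm. For a non-unital algebra $A$ (one without an identity element) let $A_e = A\oplus\mathbb{C}1$ be its unitization. An algebra $A$ has the spectral extension property (SEP) if $r_A(a)=r_B(a)$ for every $a\in A$ and every Banach algebra $B$ that contains $A$ as a (not necessarily closed) subalgebra, where $r_A$, $r_B$ denote the spectral radii (spectra in an algebra without identity being taken in its unitization). For a norm $|\cdot|$ on $A$ and $a\in A$, the spatial numerical range of $a$ is $$V_A(a)=\{\varphi(ax) : x\in A,\ \varphi\in (A,|\cdot|)^*,\ |x|=1=\|\varphi\|=\varphi(x)\},$$ and $\overline{co}$ denotes the closed convex hull. For a norm $|\cdot|$ on $A$ (in particular for the restriction to $A$ of a norm on $A_e$) put, for $a\in A$ and $\lambda\in\mathbb{C}$, $$|a+\lambda 1|_{op}=\sup\{|ax+\lambda x| : x\in A,\ |x|\le 1\},\qquad |a+\lambda 1|_1=|a|+|\lambda| .$$ A norm on an algebra is minimal if no other norm on that algebra is pointwise less than or equal to it, and $\cong$ denotes equivalence of norms. **Theorem.** Let $A$ be a non-unital, semisimple Banach algebra (that is, with zero Jacobson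 radical), and suppose that $A$ has SEP. Then the following are equivalent: 1. $A_e$ has SEP; 2. $A$ is closed in $(A_e,|\cdot|)$ for every norm $|\cdot|$ on $A_e$; 3. for every norm $|\cdot|$ on $A$ and every $a\in A$, $0\in\overline{co}\,V_A(a)$, where $V_A(a)$ is formed with respect to $|\cdot|$; 4. $|\cdot|_{op}\cong|\cdot|_1$ on $A_e$ for every minimal norm $|\cdot|$ on $A_e$. -/

import Mathlib

universe u

noncomputable section

namespace SpectralExtension

section Algebraic

variable {A : Type u} [NonUnitalRing A] [Module ℂ A]

/-- The spectral radius of an element of a (not necessarily unital) complex algebra.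
The quasispectrum of `a` is the spectrum of `a` in the unitization; if the algebra has an identity
it is the spectrum of `a` with the point `0` added, which does not affect the supremum. -/
def specRadius (a : A) : ENNReal := ⨆ z ∈ quasispectrum ℂ a, ‖z‖ₑ

/-- The spectral extension property: in every Banach algebra `B` that contains `A` as a (not
necessarily closed) subalgebra, each element of `A` has the same spectral radius as in `A`. (`B`
need not share an identity with `A`. The universe of `A` is large enough for `B`, because the
completions of `A` and the closure of `A` in any `B` have models in it.) -/
def HasSEP (A : Type u) [NonUnitalRing A] [Module ℂ A] : Prop :=
  ∀ (B : Type u) [NonUnitalNormedRing B] [NormedSpace ℂ B] [IsScalarTower ℂ B B]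
    [SMulCommClass ℂ B B] [CompleteSpace B] (ι : A →ₙₐ[ℂ] B),
    Function.Injective ι → ∀ a : A, specRadius a = specRadius (ι a)

/-- A norm on a complex algebra: a (not necessarily complete) submultiplicative vector space
norm. -/
structure IsAlgNorm (p : A → ℝ) : Prop where
  eq_zero : ∀ x, p x = 0 → x = 0
  smul : ∀ (c : ℂ) x, p (c • x) = ‖c‖ * p x
  add_le : ∀ x y, p (x + y) ≤ p x + p y
  mul_le : ∀ x y, p (x * y) ≤ p x * p y

/-- A norm that is minimal for the pointwise order among all norms on the algebra. -/
def IsMinimalNorm (p : A → ℝ) : Prop :=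
  IsAlgNorm p ∧ ∀ q : A → ℝ, IsAlgNorm q → (∀ x, q x ≤ p x) → q = p

/-- The set `S` is closed in the topology of the norm `p`: it contains every point of its
`p`-closure. -/
def IsClosedFor (p : A → ℝ) (S : Set A) : Prop :=
  ∀ b, (∀ ε > 0, ∃ s ∈ S, p (b - s) < ε) → b ∈ S

/-- The spatial numerical range of `a` in `(A, p)`: the values `φ (a * x)`, where `x` is a unit
vector of `(A, p)` and `φ` is a functional in its dual with `‖φ‖ = φ x = 1`. As `p x = φ x = 1`,
the condition `‖φ‖ = 1` amounts to `‖φ y‖ ≤ p y` for all `y`. -/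
def spatialNumericalRange (p : A → ℝ) (a : A) : Set ℂ :=
  {z | ∃ (x : A) (φ : A →ₗ[ℂ] ℂ),
    p x = 1 ∧ (∀ y, ‖φ y‖ ≤ p y) ∧ φ x = 1 ∧ z = φ (a * x)}

/-- The operator norm on the unitization induced by a norm `p` on `A`. -/
def opNorm (p : A → ℝ) (b : Unitization ℂ A) : ℝ :=
  sSup {t | ∃ x : A, p x ≤ 1 ∧ t = p (b.snd * x + b.fst • x)}

/-- The `ℓ¹`-norm on the unitization induced by a norm `p` on `A`. -/
def l1Norm (p : A → ℝ) (b : Unitization ℂ A) : ℝ :=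
  p b.snd + ‖b.fst‖

end Algebraic

/-- Equivalence of norms. -/
def EquivNorms {E : Type u} (p q : E → ℝ) : Prop :=
  ∃ c > 0, ∃ C > 0, ∀ x, c * p x ≤ q x ∧ q x ≤ C * p x

/-- `A` is semisimple: its Jacobson radical, the intersection of `A` with the Jacobson radical of
the unitization, is zero. -/
def IsSemisimpleAlg (A : Type u) [NonUnitalRing A] [Module ℂ A] [IsScalarTower ℂ A A]
    [SMulCommClass ℂ A A] : Prop :=
  ∀ a : A, (Unitization.inr a : Unitization ℂ A) ∈ Ring.jacobson (Unitization ℂ A) → a = 0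

end SpectralExtension

end

/-! Each condition says that the canonical character `b ↦ b.fst` of `A_e` is contractive for every
norm on `A_e`. If its kernel `A` is closed, the character is bounded, and powers reduce the bound to
1. For 1 ↔ 2, SEP makes every norm dominate the spectral radius, and `b.fst` is a spectral value;
conversely the spectrum of `b` is that of `b.snd` shifted by `b.fst`. For 2 ↔ 3, separation and a
supporting functional relate `0 ∈ co V(a)` to `|λ| ≤ |a + λ|_op`. For 2 ↔ 4, a minimal norm that is
pointwise above its own operator norm equals it, and Zorn's lemma puts a minimal norm below every
norm: SEP of `A` and semisimplicity keep infima of chains definite (`isAlgNorm_iInf`). -/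

noncomputable section

namespace SpectralExtension

/-! ### Algebra norms -/

section AlgNorm

variable {A : Type u} [NonUnitalRing A] [Module ℂ A] {p : A → ℝ}

namespace IsAlgNorm

lemma map_zero (hp : IsAlgNorm p) : p 0 = 0 := by
  simpa using hp.smul 0 0

lemma map_neg (hp : IsAlgNorm p) (x : A) : p (-x) = p x := by
  simpa using hp.smul (-1) x

lemma nonneg (hp : IsAlgNorm p) (x : A) : 0 ≤ p x := by
  have h := hp.add_le x (-x)
  rw [add_neg_cancel, hp.map_zero, hp.map_neg] at h
  linarith

lemma sub_le (hp : IsAlgNorm p) (x y : A) : p (x - y) ≤ p x + p y := by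
  simpa [sub_eq_add_neg, hp.map_neg] using hp.add_le x (-y)

lemma pos (hp : IsAlgNorm p) {x : A} (hx : x ≠ 0) : 0 < p x :=
  (hp.nonneg x).lt_of_ne fun h => hx (hp.eq_zero x h.symm)

/-- The normed ring structure given by an algebra norm. -/
abbrev toNonUnitalNormedRing (hp : IsAlgNorm p) : NonUnitalNormedRing A :=
  letI : Norm A := ⟨p⟩
  letI core : NormedSpace.Core ℂ A :=
    { norm_nonneg := hp.nonneg
      norm_smul := hp.smul
      norm_triangle := hp.add_le
      norm_eq_zero_iff := fun x => ⟨hp.eq_zero x, fun h => h ▸ hp.map_zero⟩ }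
  { ‹NonUnitalRing A›, NormedAddCommGroup.ofCore core with
    norm_mul_le := hp.mul_le }

/-- The normed space structure given by an algebra norm. -/
abbrev toNormedSpace (hp : IsAlgNorm p) :
    letI := hp.toNonUnitalNormedRing
    NormedSpace ℂ A :=
  letI := hp.toNonUnitalNormedRing
  { ‹Module ℂ A› with norm_smul_le := fun c x => (hp.smul c x).le }

lemma comp_injective {B : Type*} [NonUnitalRing B] [Module ℂ B] {q : B → ℝ} (hq : IsAlgNorm q)
    (f : A →ₙₐ[ℂ] B) (hf : Function.Injective f) : IsAlgNorm fun a => q (f a) where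
  eq_zero x hx := hf (by rw [hq.eq_zero _ hx, _root_.map_zero])
  smul c x := by simp [hq.smul]
  add_le x y := by simpa using hq.add_le (f x) (f y)
  mul_le x y := by simpa using hq.mul_le (f x) (f y)

end IsAlgNorm

lemma IsAlgNorm.pow_succ_le {R : Type u} [Ring R] [Algebra ℂ R] {p : R → ℝ} (hp : IsAlgNorm p)
    (b : R) (n : ℕ) : p (b ^ (n + 1)) ≤ p b ^ (n + 1) := by
  induction n with
  | zero => simp
  | succ n ih =>
    rw [pow_succ b, pow_succ (p b)]
    exact (hp.mul_le _ _).trans (mul_le_mul_of_nonneg_right ih (hp.nonneg b))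

/-- Removes the constant from any estimate that can be applied to all powers of an element. -/
lemma le_of_forall_mul_pow_succ_le {s t ε : ℝ} (ht : 0 ≤ t) (hε : 0 < ε)
    (h : ∀ n : ℕ, ε * s ^ (n + 1) ≤ t ^ (n + 1)) : s ≤ t := by
  by_contra! hlt
  have hs : 0 < s := ht.trans_lt hlt
  obtain ⟨n, hn⟩ := exists_pow_lt_of_lt_one hε ((div_lt_one hs).2 hlt)
  have h2 : (t / s) ^ (n + 1) ≤ (t / s) ^ n :=
    pow_le_pow_of_le_one (div_nonneg ht hs.le) ((div_lt_one hs).2 hlt).le n.le_succ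
  have h3 := h2.trans_lt hn
  rw [div_pow, div_lt_iff₀ (pow_pos hs _)] at h3
  exact (h n).not_gt h3

end AlgNorm

/-! ### SEP and domination of the spectral radius -/

section SpectralRadius

open WithLp in
lemma norm_le_of_mem_quasispectrum {B : Type*} [NonUnitalNormedRing B] [NormedSpace ℂ B]
    [IsScalarTower ℂ B B] [SMulCommClass ℂ B B] [CompleteSpace B] {b : B} {z : ℂ}
    (hz : z ∈ quasispectrum ℂ b) : ‖z‖ ≤ ‖b‖ := by
  rw [Unitization.quasispectrum_eq_spectrum_inr,
    ← AlgEquiv.spectrum_eq (unitizationAlgEquiv (𝕜 := ℂ) (A := B) ℂ).symm] at hz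
  have h := spectrum.norm_le_norm_mul_of_mem hz
  have h1 : ‖(1 : WithLp 1 (Unitization ℂ B))‖ = 1 := by
    rw [unitization_norm_def]
    change ‖(1 : ℂ)‖ + ‖(0 : B)‖ = 1
    simp
  rw [h1, mul_one] at h
  exact h.trans_eq (unitization_norm_inr b)

/-- The completion of the `ℓ¹`-unitization is a Banach algebra containing `A` isometrically; there
the norm dominates the spectral radius. -/
lemma HasSEP.norm_le_norm {A : Type u} [NonUnitalNormedRing A] [NormedSpace ℂ A]
    [IsScalarTower ℂ A A] [SMulCommClass ℂ A A] (hSEP : HasSEP A) (a : A) {z : ℂ}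
    (hz : z ∈ quasispectrum ℂ a) : ‖z‖ ≤ ‖a‖ := by
  let U := WithLp 1 (Unitization ℂ A)
  have : IsScalarTower ℂ (UniformSpace.Completion U) (UniformSpace.Completion U) :=
    @IsScalarTower.right ℂ (UniformSpace.Completion U) _ _ (UniformSpace.Completion.algebra U ℂ)
  have : SMulCommClass ℂ (UniformSpace.Completion U) (UniformSpace.Completion U) :=
    @Algebra.to_smulCommClass ℂ (UniformSpace.Completion U) _ _
      (UniformSpace.Completion.algebra U ℂ)
  let ι : A →ₙₐ[ℂ] UniformSpace.Completion U :=
    { toFun := fun x => ((WithLp.toLp 1 (x : Unitization ℂ A) : U) : UniformSpace.Completion U)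
      map_smul' := fun c x => by
        rw [← UniformSpace.Completion.coe_smul]
        congr 1
        simp
      map_zero' := by
        rw [← UniformSpace.Completion.coe_zero]
        rfl
      map_add' := fun x y => by
        rw [← UniformSpace.Completion.coe_add]
        congr 1
        simp
      map_mul' := fun x y => by
        rw [← UniformSpace.Completion.coe_mul]
        congr 1
        exact congrArg (WithLp.toLp 1) (Unitization.inr_mul ℂ x y) }
  have hnorm (x : A) : ‖ι x‖ = ‖x‖ :=
    (UniformSpace.Completion.norm_coe _).trans (WithLp.unitization_norm_inr x)
  have hinj : Function.Injective ι := by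
    rw [injective_iff_map_eq_zero]
    intro x hx
    rw [← norm_eq_zero, ← hnorm, hx, norm_zero]
  have hrad := hSEP (UniformSpace.Completion U) ι hinj a
  have h1 : ‖z‖ₑ ≤ specRadius a := le_iSup₂ (f := fun z (_ : z ∈ quasispectrum ℂ a) => ‖z‖ₑ) z hz
  have h2 : specRadius (ι a) ≤ ‖ι a‖ₑ := by
    refine iSup₂_le fun w hw => ?_
    have := norm_le_of_mem_quasispectrum hw
    rwa [enorm_le_iff_norm_le]
  rw [← hnorm, ← enorm_le_iff_norm_le]
  exact h1.trans (hrad.trans_le h2)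

lemma HasSEP.norm_le {A : Type u} [NonUnitalRing A] [Module ℂ A]
    [IsScalarTower ℂ A A] [SMulCommClass ℂ A A] (hSEP : HasSEP A) {p : A → ℝ} (hp : IsAlgNorm p)
    {a : A} {z : ℂ} (hz : z ∈ quasispectrum ℂ a) : ‖z‖ ≤ p a := by
  let := hp.toNonUnitalNormedRing
  let := hp.toNormedSpace
  exact hSEP.norm_le_norm a hz

open WithLp in
/-- A unital algebra in which every algebra norm dominates the spectral radius has SEP. -/
lemma hasSEP_of_norm_le {R : Type u} [Ring R] [Algebra ℂ R]
    (h : ∀ p : R → ℝ, IsAlgNorm p → ∀ b : R, ∀ z ∈ spectrum ℂ b, ‖z‖ ≤ p b) : HasSEP R := by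
  intro B _ _ _ _ _ ι hι a
  refine le_antisymm (iSup₂_le fun z hz => ?_)
    (biSup_mono (NonUnitalAlgHom.quasispectrum_apply_subset ι a))
  rcases mem_quasispectrum_iff.1 hz with rfl | hz
  · simp
  have hp : IsAlgNorm fun b : R => ‖ι b‖ :=
    { eq_zero := fun x hx => hι (by rw [norm_eq_zero.1 hx, map_zero])
      smul := fun c x => by simp [norm_smul]
      add_le := fun x y => by simpa using norm_add_le (ι x) (ι y)
      mul_le := fun x y => by simpa using norm_mul_le (ι x) (ι y) }
  let c : WithLp 1 (Unitization ℂ B) := toLp 1 (ι a : Unitization ℂ B)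
  -- Only positive powers: `ι` need not carry `1` to the adjoined identity.
  have hpow (n : ℕ) : toLp 1 ((ι (a ^ (n + 1)) : B) : Unitization ℂ B) = c ^ (n + 1) := by
    induction n with
    | zero => simp [c]
    | succ n ih =>
      rw [pow_succ a, map_mul, pow_succ c, ← ih, Unitization.inr_mul]
      rfl
  have hrad : spectralRadius ℂ c = specRadius (ι a) := by
    unfold spectralRadius specRadius
    rw [Unitization.quasispectrum_eq_spectrum_inr,
      ← AlgEquiv.spectrum_eq (unitizationAlgEquiv (𝕜 := ℂ) (A := B) ℂ).symm]
    rfl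
  rw [← hrad]
  -- Gelfand's formula, with `‖z‖ ^ n ≤ ‖c ^ n‖` by spectral mapping for powers.
  refine ge_of_tendsto (spectrum.pow_nnnorm_pow_one_div_tendsto_nhds_spectralRadius c) ?_
  filter_upwards [Filter.eventually_gt_atTop 0] with n hn
  obtain ⟨m, rfl⟩ := Nat.exists_eq_succ_of_ne_zero hn.ne'
  have h1 : ‖z‖ ^ (m + 1) ≤ ‖c ^ (m + 1)‖ := by
    rw [← norm_pow, ← hpow, unitization_norm_inr]
    exact h _ hp _ _ (spectrum.pow_mem_pow a _ hz)
  have h2 : ‖z‖ₑ ^ (m + 1) ≤ (‖c ^ (m + 1)‖₊ : ENNReal) := by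
    rw [← enorm_pow]
    change ‖z ^ (m + 1)‖ₑ ≤ ‖c ^ (m + 1)‖ₑ
    rw [enorm_le_iff_norm_le, norm_pow]
    exact h1
  calc ‖z‖ₑ = (‖z‖ₑ ^ (m + 1)) ^ (1 / ((m + 1 : ℕ) : ℝ)) := by
        rw [one_div, ENNReal.pow_rpow_inv_natCast (Nat.succ_ne_zero m)]
    _ ≤ _ := ENNReal.rpow_le_rpow h2 (by positivity)

end SpectralRadius

/-! ### Action of the unitization, and semisimplicity -/

section Unitization

variable {A : Type u} [NonUnitalRing A] [Module ℂ A]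

/-- The left action of the unitization on `A`. -/
def act (b : Unitization ℂ A) (x : A) : A := b.snd * x + b.fst • x

lemma inr_act [IsScalarTower ℂ A A] [SMulCommClass ℂ A A] (b : Unitization ℂ A) (x : A) :
    (Unitization.inr (act b x) : Unitization ℂ A) = b * Unitization.inr x := by
  ext <;> simp [act, add_comm]

lemma act_mul [IsScalarTower ℂ A A] [SMulCommClass ℂ A A] (b c : Unitization ℂ A) (x : A) :
    act (b * c) x = act b (act c x) :=
  Unitization.inr_injective (R := ℂ) (by simp only [inr_act, mul_assoc])

lemma act_add (b c : Unitization ℂ A) (x : A) : act (b + c) x = act b x + act c x := by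
  simp only [act, Unitization.fst_add, Unitization.snd_add, add_mul, add_smul]
  abel

lemma act_smul_left [IsScalarTower ℂ A A] (k : ℂ) (b : Unitization ℂ A) (x : A) :
    act (k • b) x = k • act b x := by
  simp [act, smul_mul_assoc, mul_smul]

lemma act_smul_right [SMulCommClass ℂ A A] (k : ℂ) (b : Unitization ℂ A) (x : A) :
    act b (k • x) = k • act b x := by
  simp [act, mul_smul_comm, smul_comm k b.fst]

variable [IsScalarTower ℂ A A] [SMulCommClass ℂ A A]

/-- Every `y * a` squares to zero, so `1 + y * a` has inverse `1 - y * a` and `a` lies in the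
radical. -/
lemma eq_zero_of_forall_mul_eq_zero (hss : IsSemisimpleAlg A) {a : A} (ha : ∀ x, a * x = 0) :
    a = 0 := by
  refine hss a ?_
  rw [← Ideal.jacobson_bot, Ideal.mem_jacobson_iff]
  intro y
  have h : y * Unitization.inr a * (y * Unitization.inr a) = 0 := by
    rw [← inr_act, ← Unitization.inr_mul]
    have : act y a * act y a = 0 := by
      simp only [act, add_mul, mul_assoc, smul_mul_assoc, ha]
      simp
    rw [this, Unitization.inr_zero]
  refine ⟨1 - y * Unitization.inr a, ?_⟩
  rw [Ideal.mem_bot, mul_assoc, sub_mul, h]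
  simp

/-- If `b.fst ≠ 0`, then `e = -b.snd / b.fst` is a left identity; each `x * e - x` annihilates `A`
from the left, so `e` is two-sided. -/
lemma eq_zero_of_forall_act_eq_zero (hne : ¬ ∃ e : A, ∀ a : A, e * a = a ∧ a * e = a)
    (hss : IsSemisimpleAlg A) {b : Unitization ℂ A} (hb : ∀ x, act b x = 0) : b = 0 := by
  by_cases h0 : b.fst = 0
  · have : b.snd = 0 := eq_zero_of_forall_mul_eq_zero hss fun x => by simpa [act, h0] using hb x
    ext <;> simp [h0, this]
  · refine absurd ?_ hne
    have hleft (x : A) : (-(b.fst⁻¹ • b.snd)) * x = x := by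
      have h := eq_neg_of_add_eq_zero_left (hb x)
      rw [neg_mul, smul_mul_assoc, h, smul_neg, neg_neg, inv_smul_smul₀ h0]
    refine ⟨-(b.fst⁻¹ • b.snd), fun x => ⟨hleft x, ?_⟩⟩
    refine sub_eq_zero.1 (eq_zero_of_forall_mul_eq_zero hss fun y => ?_)
    rw [sub_mul, mul_assoc, hleft, sub_self]

/-- The null elements of `q` in `A` absorb left multiplication and have no nonzero spectral values,
so they lie in the radical. -/
lemma eq_zero_of_seminorm_eq_zero (hss : IsSemisimpleAlg A) {q : Unitization ℂ A → ℝ}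
    (hmul : ∀ x y, q (x * y) ≤ q x * q y)
    (hq : ∀ a : A, ∀ z ∈ quasispectrum ℂ a, ‖z‖ ≤ q (Unitization.inr a)) {a : A}
    (ha : q (Unitization.inr a) = 0) : a = 0 := by
  refine hss a ?_
  rw [← Ideal.jacobson_bot, Ideal.mem_jacobson_iff]
  intro y
  have hle : q (Unitization.inr (act y a)) ≤ 0 := by
    rw [inr_act]
    simpa [ha] using hmul y (Unitization.inr a)
  have hnot : (-1 : ℂ) ∉ spectrum ℂ (Unitization.inr (act y a) : Unitization ℂ A) := by
    rw [← Unitization.quasispectrum_eq_spectrum_inr]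
    intro hmem
    have := (hq _ _ hmem).trans hle
    norm_num at this
  rw [spectrum.notMem_iff, inr_act] at hnot
  obtain ⟨u, hu⟩ := hnot
  have hu' : (u : Unitization ℂ A) = -(y * Unitization.inr a + 1) := by
    rw [hu, _root_.map_neg, map_one]
    abel
  refine ⟨-↑u⁻¹, ?_⟩
  have := u.inv_mul
  rw [hu', mul_neg, mul_add, mul_one] at this
  rw [Ideal.mem_bot, ← this]
  simp only [neg_mul, mul_assoc]
  abel

end Unitization

/-! ### The operator norm on the unitization -/

section OpNorm

variable {A : Type u} [NonUnitalRing A] [Module ℂ A] {p : A → ℝ}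

lemma IsAlgNorm.act_le_l1Norm (hp : IsAlgNorm p) (b : Unitization ℂ A) (x : A) :
    p (act b x) ≤ l1Norm p b * p x := by
  refine (hp.add_le _ _).trans ?_
  rw [hp.smul, l1Norm, add_mul]
  exact add_le_add_left (hp.mul_le _ _) _

lemma opNorm_le (hp : IsAlgNorm p) {b : Unitization ℂ A} {C : ℝ}
    (h : ∀ x, p x ≤ 1 → p (act b x) ≤ C) : opNorm p b ≤ C := by
  refine csSup_le ⟨_, 0, by simp [hp.map_zero], rfl⟩ ?_
  rintro _ ⟨x, hx, rfl⟩
  exact h x hx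

lemma l1Norm_nonneg (hp : IsAlgNorm p) (b : Unitization ℂ A) : 0 ≤ l1Norm p b :=
  add_nonneg (hp.nonneg _) (norm_nonneg _)

lemma opNorm_le_of_forall_le_mul (hp : IsAlgNorm p) {b : Unitization ℂ A} {C : ℝ} (hC : 0 ≤ C)
    (h : ∀ x, p (act b x) ≤ C * p x) : opNorm p b ≤ C :=
  opNorm_le hp fun x hx => (h x).trans (mul_le_of_le_one_right hC hx)

lemma opNorm_le_l1Norm (hp : IsAlgNorm p) (b : Unitization ℂ A) : opNorm p b ≤ l1Norm p b :=
  opNorm_le_of_forall_le_mul hp (l1Norm_nonneg hp b) (hp.act_le_l1Norm b)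

lemma act_le_opNorm_of_le_one (hp : IsAlgNorm p) (b : Unitization ℂ A) {x : A} (hx : p x ≤ 1) :
    p (act b x) ≤ opNorm p b := by
  refine le_csSup ⟨l1Norm p b, ?_⟩ ⟨x, hx, rfl⟩
  rintro _ ⟨y, hy, rfl⟩
  exact (hp.act_le_l1Norm b y).trans (mul_le_of_le_one_right (l1Norm_nonneg hp b) hy)

lemma opNorm_nonneg (hp : IsAlgNorm p) (b : Unitization ℂ A) : 0 ≤ opNorm p b :=
  (hp.nonneg _).trans (act_le_opNorm_of_le_one hp b (x := 0) (by simp [hp.map_zero]))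

variable [SMulCommClass ℂ A A]

lemma act_le_opNorm (hp : IsAlgNorm p) (b : Unitization ℂ A) (x : A) :
    p (act b x) ≤ opNorm p b * p x := by
  by_cases hx : x = 0
  · simp [hx, act, hp.map_zero]
  have hpos := hp.pos hx
  have hn : ‖((p x : ℝ) : ℂ)⁻¹‖ = (p x)⁻¹ := by
    rw [norm_inv, Complex.norm_real, Real.norm_of_nonneg hpos.le]
  have h := act_le_opNorm_of_le_one hp b (x := ((p x : ℝ) : ℂ)⁻¹ • x)
    (by rw [hp.smul, hn, inv_mul_cancel₀ hpos.ne'])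
  rw [act_smul_right, hp.smul, hn] at h
  rwa [inv_mul_le_iff₀ hpos, mul_comm] at h

variable [IsScalarTower ℂ A A]

lemma isAlgNorm_opNorm (hne : ¬ ∃ e : A, ∀ a : A, e * a = a ∧ a * e = a)
    (hss : IsSemisimpleAlg A) (hp : IsAlgNorm p) : IsAlgNorm (opNorm p) where
  eq_zero b hb := eq_zero_of_forall_act_eq_zero hne hss fun x =>
    hp.eq_zero _ (le_antisymm (by simpa [hb] using act_le_opNorm hp b x) (hp.nonneg _))
  smul k b := by
    have hle (k : ℂ) (b : Unitization ℂ A) : opNorm p (k • b) ≤ ‖k‖ * opNorm p b :=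
      opNorm_le_of_forall_le_mul hp (mul_nonneg (norm_nonneg _) (opNorm_nonneg hp b)) fun x => by
        rw [act_smul_left, hp.smul, mul_assoc]
        exact mul_le_mul_of_nonneg_left (act_le_opNorm hp b x) (norm_nonneg _)
    refine le_antisymm (hle k b) ?_
    by_cases hk : k = 0
    · simpa [hk] using opNorm_nonneg hp (0 : Unitization ℂ A)
    · have h := hle k⁻¹ (k • b)
      rwa [inv_smul_smul₀ hk, norm_inv, ← div_eq_inv_mul, le_div_iff₀' (norm_pos_iff.2 hk)] at h
  add_le b c := opNorm_le_of_forall_le_mul hp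
    (add_nonneg (opNorm_nonneg hp b) (opNorm_nonneg hp c)) fun x => by
      rw [act_add, add_mul]
      exact (hp.add_le _ _).trans (add_le_add (act_le_opNorm hp b x) (act_le_opNorm hp c x))
  mul_le b c := opNorm_le_of_forall_le_mul hp
    (mul_nonneg (opNorm_nonneg hp b) (opNorm_nonneg hp c)) fun x => by
      rw [act_mul, mul_assoc]
      exact (act_le_opNorm hp b _).trans
        (mul_le_mul_of_nonneg_left (act_le_opNorm hp c x) (opNorm_nonneg hp b))

lemma IsAlgNorm.comp_inr {p : Unitization ℂ A → ℝ} (hp : IsAlgNorm p) :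
    IsAlgNorm fun a : A => p (Unitization.inr a) :=
  hp.comp_injective (Unitization.inrNonUnitalAlgHom ℂ A) Unitization.inr_injective

lemma opNorm_comp_inr_le {p : Unitization ℂ A → ℝ} (hp : IsAlgNorm p) (b : Unitization ℂ A) :
    opNorm (fun a : A => p (Unitization.inr a)) b ≤ p b :=
  opNorm_le_of_forall_le_mul hp.comp_inr (hp.nonneg b) fun x => by
    rw [inr_act]
    exact hp.mul_le _ _

lemma IsAlgNorm.inr_snd_le {p : Unitization ℂ A → ℝ} (hp : IsAlgNorm p) (b : Unitization ℂ A) :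
    p (Unitization.inr b.snd) ≤ p b + ‖b.fst‖ * p 1 := by
  have hb : (Unitization.inr b.snd : Unitization ℂ A) = b - b.fst • 1 := by
    ext <;> simp [sub_eq_add_neg]
  rw [hb, ← hp.smul]
  exact hp.sub_le _ _

end OpNorm

/-! ### Closedness of `A` and the canonical character -/

section Closed

variable {A : Type u} [NonUnitalRing A] [Module ℂ A] [IsScalarTower ℂ A A] [SMulCommClass ℂ A A]
  {p : Unitization ℂ A → ℝ}

lemma isClosedFor_of_norm_fst_le {C : ℝ} (hC : 0 < C) (h : ∀ b, ‖b.fst‖ ≤ C * p b) :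
    IsClosedFor p (Set.range (Unitization.inr : A → Unitization ℂ A)) := by
  intro b hb
  have hfst : b.fst = 0 := by
    by_contra h0
    have hpos : 0 < ‖b.fst‖ := norm_pos_iff.2 h0
    obtain ⟨_, ⟨a, rfl⟩, ha⟩ := hb (‖b.fst‖ / C) (by positivity)
    have h1 := h (b - Unitization.inr a)
    have h2 : (b - Unitization.inr a : Unitization ℂ A).fst = b.fst := by simp [sub_eq_add_neg]
    rw [h2] at h1
    rw [lt_div_iff₀ hC] at ha
    linarith
  exact ⟨b.snd, by ext <;> simp [hfst]⟩

/-- If `A` is closed in its unitization, the canonical character is a contraction. -/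
lemma norm_fst_le_of_isClosedFor (hp : IsAlgNorm p)
    (hcl : IsClosedFor p (Set.range (Unitization.inr : A → Unitization ℂ A)))
    (b : Unitization ℂ A) : ‖b.fst‖ ≤ p b := by
  have h1 : (1 : Unitization ℂ A) ∉ Set.range (Unitization.inr : A → Unitization ℂ A) := by
    rintro ⟨a, ha⟩
    simpa using congrArg (fun b => b.fst) ha
  -- The distance from `1` to `A` is positive; scaling bounds the character by `1 / ε`.
  obtain ⟨ε, hε, hfar⟩ : ∃ ε > 0, ∀ a : A, ε ≤ p (1 - Unitization.inr a) := by
    by_contra! hcon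
    refine h1 (hcl 1 fun ε hε => ?_)
    obtain ⟨a, ha⟩ := hcon ε hε
    exact ⟨_, ⟨a, rfl⟩, ha⟩
  have hbd (c : Unitization ℂ A) : ε * ‖c.fst‖ ≤ p c := by
    by_cases h0 : c.fst = 0
    · simpa [h0] using hp.nonneg c
    have hc : c = c.fst • (1 - Unitization.inr (-(c.fst⁻¹ • c.snd))) := by
      ext <;> simp [h0, sub_eq_add_neg]
    conv_rhs => rw [hc, hp.smul, mul_comm]
    exact mul_le_mul_of_nonneg_right (hfar _) (norm_nonneg _)
  have hpow (n : ℕ) : ε * ‖b.fst‖ ^ (n + 1) ≤ p b ^ (n + 1) := by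
    have hfst : (b ^ (n + 1)).fst = b.fst ^ (n + 1) := map_pow (Unitization.fstHom ℂ A) b (n + 1)
    rw [← norm_pow, ← hfst]
    exact (hbd _).trans (hp.pow_succ_le b n)
  exact le_of_forall_mul_pow_succ_le (hp.nonneg b) hε hpow

end Closed

/-! ### Numerical range and operator norm -/

section NumericalRange

variable {A : Type u} [NonUnitalRing A] [Module ℂ A] {p : A → ℝ}

lemma IsAlgNorm.exists_supporting_functional (hp : IsAlgNorm p) (x : A) :
    ∃ φ : A →ₗ[ℂ] ℂ, (∀ y, ‖φ y‖ ≤ p y) ∧ φ x = p x := by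
  let := hp.toNonUnitalNormedRing
  let := hp.toNormedSpace
  obtain ⟨g, hg, hgx⟩ := exists_dual_vector'' ℂ x
  exact ⟨g.toLinearMap, fun y => g.le_of_opNorm_le_of_le hg le_rfl |>.trans_eq (one_mul _), hgx⟩

/-- The numerical range of `b.snd` lies in the closed disc about `-b.fst` of radius `opNorm p b`. -/
lemma norm_fst_le_opNorm_of_zero_mem (hp : IsAlgNorm p) {b : Unitization ℂ A}
    (h : (0 : ℂ) ∈ closure (convexHull ℝ (spatialNumericalRange p b.snd))) :
    ‖b.fst‖ ≤ opNorm p b := by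
  have hsub : spatialNumericalRange p b.snd ⊆ Metric.closedBall (-b.fst) (opNorm p b) := by
    rintro _ ⟨x, φ, hx, hφ, hφx, rfl⟩
    rw [mem_closedBall_iff_norm, sub_neg_eq_add]
    have : φ (b.snd * x) + b.fst = φ (act b x) := by simp [act, hφx]
    rw [this]
    exact (hφ _).trans (act_le_opNorm_of_le_one hp b hx.le)
  have hmem := closure_minimal (convexHull_min hsub (convex_closedBall _ _))
    Metric.isClosed_closedBall h
  simpa [mem_closedBall_iff_norm] using hmem

variable [IsScalarTower ℂ A A] [SMulCommClass ℂ A A]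

/-- If the numerical range of `c` lies in a right half plane, then `1 + αc` is expanding. -/
lemma IsAlgNorm.le_add_smul_mul (hp : IsAlgNorm p) {a : A} {w : ℂ} {u : ℝ}
    (h : ∀ z ∈ spatialNumericalRange p a, u < (w * z).re) {α : ℝ} (hα : 0 ≤ α) (x : A) :
    (1 + α * u) * p x ≤ p (x + (α : ℂ) • ((w • a) * x)) := by
  by_cases hx : x = 0
  · simp [hx, hp.map_zero]
  have hpos := hp.pos hx
  have hne : (p x : ℂ) ≠ 0 := by exact_mod_cast hpos.ne'
  obtain ⟨φ, hφ, hφx⟩ := hp.exists_supporting_functional x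
  have hz := h _ ⟨(p x : ℂ)⁻¹ • x, φ, by
    rw [hp.smul, norm_inv, Complex.norm_real, Real.norm_of_nonneg hpos.le,
      inv_mul_cancel₀ hpos.ne'], hφ, by simp [hφx, hne], rfl⟩
  set z := φ (a * (p x : ℂ)⁻¹ • x) with hzdef
  have hax : φ (a * x) = p x * z := by
    simp [hzdef, mul_smul_comm, hne]
  have hφe : φ (x + (α : ℂ) • ((w • a) * x)) = ((p x : ℝ) : ℂ) + ((α * p x : ℝ) : ℂ) * (w * z) := by
    simp only [map_add, map_smul, smul_mul_assoc, hax, hφx, smul_eq_mul]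
    push_cast
    ring
  calc (1 + α * u) * p x = p x + (α * p x) * u := by ring
    _ ≤ p x + (α * p x) * (w * z).re := by gcongr
    _ = (φ (x + (α : ℂ) • ((w • a) * x))).re := by
      rw [hφe, Complex.add_re, Complex.re_ofReal_mul, Complex.ofReal_re]
    _ ≤ _ := (Complex.re_le_norm _).trans (hφ _)

/-- Otherwise a rotated and scaled copy `c` of `a` has numerical range in `Re > u > 0`. As `(1 +
αc)(1 - αc) = 1 - α²c²` and `1 + αc` expands by `1 + αu`, `1 - αc` has operator norm below 1 for
small `α > 0`, yet its character value is 1. -/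
lemma zero_mem_closure_convexHull_of_norm_fst_le (hp : IsAlgNorm p)
    (h : ∀ b, ‖b.fst‖ ≤ opNorm p b) (a : A) :
    (0 : ℂ) ∈ closure (convexHull ℝ (spatialNumericalRange p a)) := by
  by_contra hnot
  obtain ⟨f, u, hu, hf⟩ := RCLike.geometric_hahn_banach_point_closed (𝕜 := ℂ)
    (convex_convexHull ℝ (spatialNumericalRange p a)).closure isClosed_closure hnot
  have hu0 : 0 < u := by simpa using hu
  have hf' : ∀ z ∈ spatialNumericalRange p a, u < (f 1 * z).re := fun z hz => by
    have h1 := hf z (subset_closure (subset_convexHull ℝ _ hz))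
    have h2 : f z = f 1 * z := by
      conv_lhs => rw [← mul_one z, ← smul_eq_mul, map_smul, smul_eq_mul, mul_comm]
    rwa [h2] at h1
  set c := f 1 • a with hc
  have hK : 0 ≤ p (c * c) := hp.nonneg _
  have hkey (α : ℝ) (hα : 0 < α) : u ≤ α * p (c * c) := by
    have hpos : 0 < 1 + α * u := by positivity
    have hop : opNorm p (1 - (α : ℂ) • Unitization.inr c) ≤
        (1 + α * (α * p (c * c))) / (1 + α * u) := by
      refine opNorm_le_of_forall_le_mul hp (by positivity) fun x => ?_
      have hact : act (1 - (α : ℂ) • Unitization.inr c) x = x - (α : ℂ) • (c * x) := by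
        simp [act, sub_eq_add_neg, add_comm, smul_mul_assoc]
      have h1 := hp.le_add_smul_mul hf' hα.le (x - (α : ℂ) • (c * x))
      rw [← hc] at h1
      have h2 : x - (α : ℂ) • (c * x) + (α : ℂ) • (c * (x - (α : ℂ) • (c * x))) =
          x - (α : ℂ) • (α : ℂ) • (c * c * x) := by
        simp only [mul_sub, smul_sub, mul_smul_comm, mul_assoc]
        abel
      have h3 : p (x - (α : ℂ) • (α : ℂ) • (c * c * x)) ≤ (1 + α * (α * p (c * c))) * p x := by
        refine (hp.sub_le _ _).trans ?_
        rw [hp.smul, hp.smul, Complex.norm_real, Real.norm_of_nonneg hα.le]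
        have : α * (α * p (c * c * x)) ≤ α * (α * (p (c * c) * p x)) := by
          gcongr
          exact hp.mul_le _ _
        linarith
      rw [h2] at h1
      rw [hact, div_mul_eq_mul_div, le_div_iff₀ hpos, mul_comm]
      exact h1.trans h3
    have hfst : (1 - (α : ℂ) • (Unitization.inr c : Unitization ℂ A)).fst = 1 := by
      simp [sub_eq_add_neg]
    have h4 := (h _).trans hop
    rw [hfst, norm_one, one_le_div hpos] at h4
    exact le_of_mul_le_mul_left (by linarith) hα
  -- This `α` makes `α * p (c * c)` at most `u / 2`.
  have h5 := hkey (u / (2 * (p (c * c) + 1))) (by positivity)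
  rw [div_mul_eq_mul_div, le_div_iff₀ (by positivity)] at h5
  nlinarith

end NumericalRange

/-! ### Existence of minimal norms -/

section Minimal

variable {A : Type u} [NonUnitalRing A] [Module ℂ A] [IsScalarTower ℂ A A] [SMulCommClass ℂ A A]

/-- The infimum of a downward directed family of algebra norms on the unitization is a norm. -/
lemma isAlgNorm_iInf (hne : ¬ ∃ e : A, ∀ a : A, e * a = a ∧ a * e = a)
    (hss : IsSemisimpleAlg A) (hSEP : HasSEP A) {ι : Type*} [Nonempty ι]
    {q : ι → Unitization ℂ A → ℝ} (hq : ∀ i, IsAlgNorm (q i))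
    (hdir : ∀ i j, ∃ k, q k ≤ q i ∧ q k ≤ q j) : IsAlgNorm fun b => ⨅ i, q i b := by
  have hbdd (b : Unitization ℂ A) : BddBelow (Set.range fun i => q i b) :=
    ⟨0, by rintro _ ⟨i, rfl⟩; exact (hq i).nonneg b⟩
  have hnn (b : Unitization ℂ A) : 0 ≤ ⨅ i, q i b := Real.iInf_nonneg fun i => (hq i).nonneg b
  have hmul (x y : Unitization ℂ A) : ⨅ i, q i (x * y) ≤ (⨅ i, q i x) * ⨅ i, q i y := by
    rw [Real.mul_iInf_of_nonneg (hnn x)]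
    refine le_ciInf fun j => ?_
    rw [Real.iInf_mul_of_nonneg ((hq j).nonneg y)]
    refine le_ciInf fun i => ?_
    obtain ⟨k, hki, hkj⟩ := hdir i j
    exact (ciInf_le (hbdd _) k).trans (((hq k).mul_le x y).trans
      (mul_le_mul (hki x) (hkj y) ((hq k).nonneg y) ((hq i).nonneg x)))
  refine ⟨fun b hb => eq_zero_of_forall_act_eq_zero hne hss fun x => ?_, fun c b => ?_,
    fun x y => ?_, hmul⟩
  -- If the infimum vanishes at `b`, it vanishes at `b * x ∈ A`; on `A` it still dominates the
  -- spectral radius, by SEP.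
  · refine eq_zero_of_seminorm_eq_zero (q := fun b => ⨅ i, q i b) hss hmul
      (fun a z hz => le_ciInf fun i => hSEP.norm_le (hq i).comp_inr hz) ?_
    refine le_antisymm ?_ (hnn _)
    rw [inr_act]
    exact (hmul b _).trans_eq (by rw [hb, zero_mul])
  · rw [Real.mul_iInf_of_nonneg (norm_nonneg c)]
    simp only [(hq _).smul]
  · refine le_ciInf_add_ciInf fun i j => ?_
    obtain ⟨k, hki, hkj⟩ := hdir i j
    exact (ciInf_le (hbdd _) k).trans (((hq k).add_le x y).trans (add_le_add (hki x) (hkj y)))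

lemma exists_isMinimalNorm_le (hne : ¬ ∃ e : A, ∀ a : A, e * a = a ∧ a * e = a)
    (hss : IsSemisimpleAlg A) (hSEP : HasSEP A) {p : Unitization ℂ A → ℝ} (hp : IsAlgNorm p) :
    ∃ q, IsMinimalNorm q ∧ q ≤ p := by
  have hchain (c) (hc : c ⊆ {q : (Unitization ℂ A → ℝ)ᵒᵈ | IsAlgNorm (OrderDual.ofDual q)})
      (hch : IsChain (· ≤ ·) c) (y) (hy : y ∈ c) :
      ∃ m ∈ {q : (Unitization ℂ A → ℝ)ᵒᵈ | IsAlgNorm (OrderDual.ofDual q)}, ∀ z ∈ c, z ≤ m := by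
    have : Nonempty c := ⟨⟨y, hy⟩⟩
    refine ⟨OrderDual.toDual fun b => ⨅ q : c, OrderDual.ofDual q.1 b,
      isAlgNorm_iInf hne hss hSEP (fun q => hc q.2) fun i j => ?_, fun z hz b =>
        ciInf_le ⟨0, by rintro _ ⟨q, rfl⟩; exact (hc q.2).nonneg b⟩ (⟨z, hz⟩ : c)⟩
    rcases hch.total i.2 j.2 with h | h
    · exact ⟨j, h, le_rfl⟩
    · exact ⟨i, le_rfl, h⟩
  obtain ⟨m, hm, hmin⟩ := zorn_le_nonempty₀ _ hchain (OrderDual.toDual p) hp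
  exact ⟨OrderDual.ofDual m, ⟨hmin.1, fun q hq hle =>
    le_antisymm hle (hmin.2 (y := OrderDual.toDual q) hq hle)⟩, hm⟩

end Minimal

/-! ### Spectra in the unitization -/

section Equivalences

variable {A : Type u} [NonUnitalRing A] [Module ℂ A] [IsScalarTower ℂ A A] [SMulCommClass ℂ A A]

lemma isClosedFor_of_hasSEP_unitization (h : HasSEP (Unitization ℂ A))
    {p : Unitization ℂ A → ℝ} (hp : IsAlgNorm p) :
    IsClosedFor p (Set.range (Unitization.inr : A → Unitization ℂ A)) :=
  isClosedFor_of_norm_fst_le one_pos fun b => by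
    rw [one_mul]
    exact h.norm_le hp (spectrum_subset_quasispectrum ℂ b
      (AlgHom.apply_mem_spectrum (Unitization.fstHom ℂ A) b))

lemma norm_sub_fst_le_of_mem_spectrum (hSEP : HasSEP A) {p : Unitization ℂ A → ℝ}
    (hp : IsAlgNorm p) {b : Unitization ℂ A} {z : ℂ} (hz : z ∈ spectrum ℂ b) :
    ‖z - b.fst‖ ≤ p (Unitization.inr b.snd) := by
  refine hSEP.norm_le hp.comp_inr ?_
  rw [Unitization.quasispectrum_eq_spectrum_inr]
  have hb : (Unitization.inr b.snd : Unitization ℂ A) = b - algebraMap ℂ _ b.fst := by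
    ext <;> simp [sub_eq_add_neg, Unitization.algebraMap_eq_inl]
  rw [spectrum.mem_iff] at hz ⊢
  rwa [hb, map_sub, sub_sub_sub_cancel_right]

lemma norm_le_of_mem_spectrum_of_isClosedFor (hSEP : HasSEP A) {p : Unitization ℂ A → ℝ}
    (hp : IsAlgNorm p)
    (hcl : IsClosedFor p (Set.range (Unitization.inr : A → Unitization ℂ A)))
    {b : Unitization ℂ A} {z : ℂ} (hz : z ∈ spectrum ℂ b) : ‖z‖ ≤ p b := by
  -- `‖w‖ ≤ p (c.snd) + ‖c.fst‖ ≤ p c + ‖c.fst‖ * p 1 + ‖c.fst‖`, with `‖c.fst‖ ≤ p c`.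
  have hone (c : Unitization ℂ A) {w : ℂ} (hw : w ∈ spectrum ℂ c) : ‖w‖ ≤ (2 + p 1) * p c := by
    have h1 := norm_sub_fst_le_of_mem_spectrum hSEP hp hw
    have h2 := norm_fst_le_of_isClosedFor hp hcl c
    have h3 := hp.inr_snd_le c
    have h5 := mul_le_mul_of_nonneg_right h2 (hp.nonneg 1)
    have h4 : ‖w‖ ≤ ‖w - c.fst‖ + ‖c.fst‖ := by simpa using norm_add_le (w - c.fst) c.fst
    linarith
  have hC : 0 < 2 + p 1 := by linarith [hp.nonneg 1]
  refine le_of_forall_mul_pow_succ_le (hp.nonneg b) (inv_pos.2 hC) fun n => ?_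
  rw [inv_mul_le_iff₀ hC, ← norm_pow]
  exact (hone _ (spectrum.pow_mem_pow b _ hz)).trans
    (mul_le_mul_of_nonneg_left (hp.pow_succ_le b n) hC.le)

end Equivalences

end SpectralExtension

end

theorem mainTheorem1 {A : Type u} [NonUnitalNormedRing A] [NormedSpace ℂ A]
    [IsScalarTower ℂ A A] [SMulCommClass ℂ A A] [CompleteSpace A]
    (hnonunital : ¬ ∃ e : A, ∀ a : A, e * a = a ∧ a * e = a)
    (hsemisimple : SpectralExtension.IsSemisimpleAlg A)
    (hSEP : SpectralExtension.HasSEP A) :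
    List.TFAE [
      SpectralExtension.HasSEP (Unitization ℂ A),
      ∀ p : Unitization ℂ A → ℝ, SpectralExtension.IsAlgNorm p →
        SpectralExtension.IsClosedFor p (Set.range (Unitization.inr : A → Unitization ℂ A)),
      ∀ p : A → ℝ, SpectralExtension.IsAlgNorm p → ∀ a : A,
        (0 : ℂ) ∈ closure (convexHull ℝ (SpectralExtension.spatialNumericalRange p a)),
      ∀ p : Unitization ℂ A → ℝ, SpectralExtension.IsMinimalNorm p →
        SpectralExtension.EquivNorms
          (SpectralExtension.opNorm fun a : A => p (Unitization.inr a))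
          (SpectralExtension.l1Norm fun a : A => p (Unitization.inr a))] := by
  open SpectralExtension in
  tfae_have 1 → 2 := fun h p hp => isClosedFor_of_hasSEP_unitization h hp
  tfae_have 2 → 1 := fun h => hasSEP_of_norm_le fun p hp b z hz =>
    norm_le_of_mem_spectrum_of_isClosedFor hSEP hp (h p hp) hz
  tfae_have 2 → 3 := fun h p hp => by
    have hop := isAlgNorm_opNorm hnonunital hsemisimple hp
    exact zero_mem_closure_convexHull_of_norm_fst_le hp
      (norm_fst_le_of_isClosedFor hop (h _ hop))
  tfae_have 3 → 2 := fun h p hp => isClosedFor_of_norm_fst_le one_pos fun b => by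
    rw [one_mul]
    exact (norm_fst_le_opNorm_of_zero_mem hp.comp_inr (h _ hp.comp_inr b.snd)).trans
      (opNorm_comp_inr_le hp b)
  tfae_have 2 → 4 := fun h p hp => by
    have hop := isAlgNorm_opNorm hnonunital hsemisimple hp.1.comp_inr
    have hp1 := hp.1.nonneg 1
    refine ⟨1, one_pos, 2 + p 1, by linarith, fun b =>
      ⟨(one_mul _).trans_le (opNorm_le_l1Norm hp.1.comp_inr b), ?_⟩⟩
    -- Minimality identifies `p` with the operator norm that it dominates.
    rw [hp.2 _ hop (opNorm_comp_inr_le hp.1)]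
    have h2 := norm_fst_le_of_isClosedFor hp.1 (h p hp.1) b
    have h3 := hp.1.inr_snd_le b
    have h4 := mul_le_mul_of_nonneg_right h2 hp1
    simp only [l1Norm]
    linarith
  tfae_have 4 → 2 := fun h p hp => by
    obtain ⟨q, hq, hqp⟩ := exists_isMinimalNorm_le hnonunital hsemisimple hSEP hp
    obtain ⟨_, _, C, hC, hle⟩ := h q hq
    refine isClosedFor_of_norm_fst_le hC fun b => ?_
    calc ‖b.fst‖ ≤ l1Norm (fun a : A => q (Unitization.inr a)) b :=
          le_add_of_nonneg_left (hq.1.nonneg _)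
      _ ≤ C * opNorm (fun a : A => q (Unitization.inr a)) b := (hle b).2
      _ ≤ C * p b := by
        gcongr
        exact (opNorm_comp_inr_le hq.1 b).trans (hqp b)
  tfae_finish
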